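/- **Setting.** Let $n\ge 2$ and $k\ge 2$. Let $\Omega$ be a measurable space of solutions, $x:\Omega\to\mathbb R$ the principal's utility function and $y_i:\Omega\to\mathbb R$ the utility function of agent $i\in\{1,\dots,n\}$, all measurable. The agents are symmetric: each agent $i$ observes $k$ solutions $\bar\omega_i=(\omega_{i,1},\dots,\omega_{i,k})$, and the $nk$ solutions $\omega_{i,j}$ are i.i.d. with a distribution $D$ on $\Omega$. For every $i$, under $D$ the variables $x(\omega)$ and $y_i(\omega)$ are independent and each is uniformly distributed on $[0,1]$. Information is incomplete: agent $i$ sees only $\bar\omega_i$ and knows the distribution of the other agents' solutions. **Mechanism.** Consider the multi-agent single-proposal mechanism (MSPM) with no eligible set, with an arbitrary deterministic tie-breaking rule $\rho$ that picks an agent from each nonempty set of tied agents. Each agent proposes at most one of his observed solutions, and the principal selects a proposal maximizing $x$, ties being broken by $\rho$. If the selected solution $\omega$ was proposed by agent $i$, then the principal gets $x(\omega)$, agent $i$ gets $y_i(\omega)$ and the other agents get $0$; if nothing is proposed, everybody gets $0$. The mechanism is prior-independent: it does not depend on $D$, on $k$ or on the functions $y_i$. **Equilibrium.** A strategy $\sigma_i$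 is a measurable rule that selects, from the observed $\bar\omega_i$, one of these solutions or none. Let $u_i(\sigma_i,\sigma_{-i})$ be agent $i$'s expected utility, over all observed solutions. A profile $\sigma$ is an $\varepsilon$-approximate Bayes–Nash equilibrium if $u_i(\sigma_i,\sigma_{-i})\ge u_i(\sigma_i',\sigma_{-i})-\varepsilon$ for every $i$ and every strategy $\sigma_i'$ of agent $i$. Call $\sigma$ *$x$-best* if every agent always proposes one of his observed solutions with the largest value of $x$. **Theorem.** An $x$-best profile exists, even one in which no agent ever proposes a solution when another of his observed solutions is at least as good for both him and the principal and strictly better for one of them. Every $x$-best profile $\sigma$ is an $\varepsilon_n$-approximate Bayes–Nash equilibrium of this mechanism, where $$\varepsilon_n = 1-\exp\left(-\frac{n^2}{2(n-1)^2}\right),$$ and under $\sigma$ the principal's expected utility equals the optimum $\mathbb E[X_{\max}]$, where $X_{\max}=\max_{i\le n}\max_{j\le k} x(\omega_{i,j})$. Moreover, $\varepsilon_n\to 1-1/\sqrt e$ as $n\to\infty$. -/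

import Mathlib

open MeasureTheory ProbabilityTheory

noncomputable section

namespace Delegation

/-- The agents' side of a delegation instance with `n` agents and solution space `Ω`: agent `i`
observes `k i` solutions, the `j`-th one drawn from the distribution `D i j` on `Ω`, and has utility
function `y i`. The null outcome (no solution is adopted, all utilities are `0`) is not a point of
`Ω`; it is represented by `none : Option _` below. -/
structure Agents (n : ℕ) (Ω : Type*) [MeasurableSpace Ω] where
  k : Fin n → ℕ
  D : (i : Fin n) → Fin (k i) → Measure Ω
  prob : ∀ i j, IsProbabilityMeasure (D i j)
  y : Fin n → Ω → ℝ
  measurable_y : ∀ i, Measurable (y i)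

attribute [instance] Agents.prob

/-- A deterministic tie-breaking rule: it selects a member of every nonempty set of tied agents. -/
structure TieBreakingRule (n : ℕ) where
  choose : Finset (Fin n) → Fin n
  choose_mem : ∀ T : Finset (Fin n), T.Nonempty → choose T ∈ T

/-- A multi-agent single-proposal mechanism: the principal announces an eligible set for each agent
and a tie-breaking rule. Nothing in it refers to the distributions of the solutions. -/
structure MSPM (n : ℕ) (Ω : Type*) [MeasurableSpace Ω] where
  eligible : Fin n → Set Ω
  measurableSet_eligible : ∀ i, MeasurableSet (eligible i)
  tieBreak : TieBreakingRule n

namespace MSPM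

variable {n : ℕ} {Ω : Type*} [MeasurableSpace Ω]

/-- The mechanism with no eligible set: every solution is admitted from every agent. -/
def unrestricted (n : ℕ) (Ω : Type*) [MeasurableSpace Ω] (ρ : TieBreakingRule n) : MSPM n Ω where
  eligible := fun _ => Set.univ
  measurableSet_eligible := fun _ => MeasurableSet.univ
  tieBreak := ρ

open Classical in
/-- The agents whose proposal is eligible and maximizes the principal's utility `x` among all
eligible proposals. The profile `p` lists the proposals; `p i = none` if agent `i` proposes nothing. -/
def best (M : MSPM n Ω) (x : Ω → ℝ) (p : Fin n → Option Ω) : Finset (Fin n) :=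
  Finset.univ.filter fun i => ∃ ω, p i = some ω ∧ ω ∈ M.eligible i ∧
    ∀ j ω', p j = some ω' → ω' ∈ M.eligible j → x ω' ≤ x ω

open Classical in
/-- The agent whose proposal is the winner; `none` if there is no eligible proposal. -/
def winner (M : MSPM n Ω) (x : Ω → ℝ) (p : Fin n → Option Ω) : Option (Fin n) :=
  if (M.best x p).Nonempty then some (M.tieBreak.choose (M.best x p)) else none

/-- The principal's realized utility: `x` of the winning solution, and `0` if there is none. -/
def principalPayoff (M : MSPM n Ω) (x : Ω → ℝ) (p : Fin n → Option Ω) : ℝ :=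
  (M.winner x p).elim 0 fun i => (p i).elim 0 x

/-- The realized utility of agent `i` with utility function `yi`: `yi` of the winning solution if
it belongs to agent `i`, and `0` otherwise. -/
def agentPayoff (M : MSPM n Ω) (x : Ω → ℝ) (i : Fin n) (yi : Ω → ℝ) (p : Fin n → Option Ω) : ℝ :=
  if M.winner x p = some i then (p i).elim 0 yi else 0

end MSPM

namespace Agents

variable {n : ℕ} {Ω : Type*} [MeasurableSpace Ω]

/-- The distribution of the solutions observed by agent `i` (independent draws). -/
def agentPrior (A : Agents n Ω) (i : Fin n) : Measure (Fin (A.k i) → Ω) :=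
  Measure.pi fun j => A.D i j

/-- The distribution of all observed solutions (independent across agents). -/
def prior (A : Agents n Ω) : Measure ((i : Fin n) → Fin (A.k i) → Ω) :=
  Measure.pi fun i => A.agentPrior i

/-- A strategy of agent `i`: from the solutions that he observes, he selects the one to propose
(given by its index), or none. He cannot propose a solution that he has not observed. -/
structure Strategy (A : Agents n Ω) (i : Fin n) where
  select : (Fin (A.k i) → Ω) → Option (Fin (A.k i))
  measurableSet_select : ∀ j, MeasurableSet {v | select v = some j}

/-- The proposal sent when the solutions `v` are observed. -/
def Strategy.signal {A : Agents n Ω} {i : Fin n} (s : A.Strategy i) (v : Fin (A.k i) → Ω) :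
    Option Ω :=
  (s.select v).map v

/-- `u_i(s, σ_{-i})`: the interim expected utility of agent `i` when he sends the proposal `s` and
the others play `σ`; the expectation is over the others' solutions (the entry `i` of the profile
and of the sample is overwritten by `s`). -/
def interimUtility (A : Agents n Ω) (x : Ω → ℝ) (M : MSPM n Ω) (i : Fin n) (s : Option Ω)
    (σ : (l : Fin n) → A.Strategy l) : ℝ :=
  ∫ w, M.agentPayoff x i (A.y i) (Function.update (fun l => (σ l).signal (w l)) i s) ∂A.prior

/-- `u_i(τ, σ_{-i})`: the expected utility of agent `i` when he plays `τ` and the others play `σ`. -/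
def expectedUtility (A : Agents n Ω) (x : Ω → ℝ) (M : MSPM n Ω) (i : Fin n) (τ : A.Strategy i)
    (σ : (l : Fin n) → A.Strategy l) : ℝ :=
  ∫ v, A.interimUtility x M i (τ.signal v) σ ∂A.agentPrior i

/-- `σ` is an `ε`-approximate Bayes-Nash equilibrium. -/
def IsApproxBNE (A : Agents n Ω) (x : Ω → ℝ) (M : MSPM n Ω) (ε : ℝ)
    (σ : (l : Fin n) → A.Strategy l) : Prop :=
  ∀ (i : Fin n) (τ : A.Strategy i),
    A.expectedUtility x M i (σ i) σ ≥ A.expectedUtility x M i τ σ - ε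

/-- The principal's expected utility when the agents play `σ`. -/
def principalUtility (A : Agents n Ω) (x : Ω → ℝ) (M : MSPM n Ω)
    (σ : (l : Fin n) → A.Strategy l) : ℝ :=
  ∫ w, M.principalPayoff x (fun i => (σ i).signal (w i)) ∂A.prior

/-- The expectation of `X_max = max_i max_j X_{i,j}`, where `X_{i,j}` is the principal's utility for
the `j`-th solution of agent `i`. -/
def opt (A : Agents n Ω) (x : Ω → ℝ) : ℝ :=
  ∫ w, (⨆ i : Fin n, ⨆ j : Fin (A.k i), x (w i j)) ∂A.prior

/-- Every agent always proposes a solution that is best for the principal among those observed. -/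
def IsXBest (A : Agents n Ω) (x : Ω → ℝ) (σ : (l : Fin n) → A.Strategy l) : Prop :=
  ∀ i v, ∃ j, (σ i).select v = some j ∧ ∀ j', x (v j') ≤ x (v j)

/-- Pareto-optimal play: no agent proposes a solution when he observes another one that is at
least as good for the principal and for himself, and strictly better for one of them. -/
def IsParetoOptimal (A : Agents n Ω) (x : Ω → ℝ) (σ : (l : Fin n) → A.Strategy l) : Prop :=
  ∀ i v j, (σ i).select v = some j → ¬ ∃ j', x (v j) ≤ x (v j') ∧ A.y i (v j) ≤ A.y i (v j') ∧
    (x (v j) < x (v j') ∨ A.y i (v j) < A.y i (v j'))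

/-- Symmetric agents: all of them draw `k₀` solutions, all from the same distribution `D₀`. -/
def IsSymmetric (A : Agents n Ω) (k₀ : ℕ) (D₀ : Measure Ω) : Prop :=
  (∀ i, A.k i = k₀) ∧ ∀ i j, A.D i j = D₀

/-- Independent utility: for a solution of agent `i`, the joint law of the utilities of the principal
and of agent `i` is the product of its marginals. -/
def IndependentUtility (A : Agents n Ω) (x : Ω → ℝ) : Prop :=
  ∀ i j, IndepFun x (A.y i) (A.D i j)

/-- For every solution of every agent `i`, the utilities of the principal and of agent `i` are
both uniformly distributed on `[0,1]`. -/
def UniformUtilities (A : Agents n Ω) (x : Ω → ℝ) : Prop :=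
  ∀ i j, pdf.IsUniform x (Set.Icc 0 1) (A.D i j) volume ∧
    pdf.IsUniform (A.y i) (Set.Icc 0 1) (A.D i j) volume

end Agents

end Delegation

end

/-! The equilibrium claim bounds the gain from a deviation by everything the deviator could ever
earn, since the utility he gives up is nonnegative. Against `x`-best opponents, a proposal `ω` can
win only if all `m = k * (n - 1)` solutions of the others have `x`-value at most `x ω`, which has
probability `x ω ^ m`. It therefore earns at most `A.y i ω * x ω ^ m`
(`IsXBest.interimUtility_some_le`). Summing over the `k` own solutions removes the dependence on the
strategy. By independence and uniformity each term has mean `1 / 2 * (1 / (m + 1))`, so no strategy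
earns more than `k / (2 * (m + 1)) ≤ 1 / (2 * (n - 1))` (`IsXBest.expectedUtility_le`). An
elementary inequality places this below the stated `ε` (`mul_half_mul_inv_le_one_sub_exp`).

The principal's optimum holds sample by sample: the best of the individual maxima is the overall
maximum. Existence comes from maximizing `(x, y_i)` lexicographically. -/

namespace Delegation

/-! ### Distribution function and moments of uniform utilities. -/

section Uniform

variable {Ω : Type*} [MeasurableSpace Ω] {D : Measure Ω} {X : Ω → ℝ}

theorem map_eq_of_isUniform_Icc (h : pdf.IsUniform X (Set.Icc 0 1) D volume) :
    D.map X = volume.restrict (Set.Icc 0 1) := by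
  have h' : D.map X = ProbabilityTheory.cond volume (Set.Icc (0 : ℝ) 1) := h
  rw [h', ProbabilityTheory.cond, Real.volume_Icc]
  simp

theorem ae_mem_Icc_of_isUniform (hX : Measurable X)
    (h : pdf.IsUniform X (Set.Icc 0 1) D volume) : ∀ᵐ ω ∂D, X ω ∈ Set.Icc (0 : ℝ) 1 := by
  have h1 : ∀ᵐ t ∂(D.map X), t ∈ Set.Icc (0 : ℝ) 1 := by
    rw [map_eq_of_isUniform_Icc h]
    exact ae_restrict_mem measurableSet_Icc
  exact ae_of_ae_map hX.aemeasurable h1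

theorem measure_le_of_isUniform (hX : Measurable X)
    (h : pdf.IsUniform X (Set.Icc 0 1) D volume) {t : ℝ} (ht : t ∈ Set.Icc (0 : ℝ) 1) :
    D {ω | X ω ≤ t} = ENNReal.ofReal t := by
  have h1 : {ω | X ω ≤ t} = X ⁻¹' Set.Iic t := rfl
  have h2 : Set.Iic t ∩ Set.Icc (0 : ℝ) 1 = Set.Icc 0 t := by
    ext s
    simp only [Set.mem_inter_iff, Set.mem_Iic, Set.mem_Icc]
    exact ⟨fun hs => ⟨hs.2.1, hs.1⟩, fun hs => ⟨hs.2, hs.1, hs.2.trans ht.2⟩⟩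
  rw [h1, ← Measure.map_apply hX measurableSet_Iic, map_eq_of_isUniform_Icc h,
    Measure.restrict_apply measurableSet_Iic, h2, Real.volume_Icc, sub_zero]

theorem integrable_pow_of_isUniform (hX : Measurable X)
    (h : pdf.IsUniform X (Set.Icc 0 1) D volume) (m : ℕ) :
    Integrable (fun ω => X ω ^ m) D := by
  have h1 : Integrable (fun t : ℝ => t ^ m) (D.map X) := by
    rw [map_eq_of_isUniform_Icc h]
    exact (continuous_pow m).continuousOn.integrableOn_compact isCompact_Icc
  exact h1.comp_measurable hX

theorem integral_pow_of_isUniform (hX : Measurable X)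
    (h : pdf.IsUniform X (Set.Icc 0 1) D volume) (m : ℕ) :
    ∫ ω, X ω ^ m ∂D = 1 / ((m : ℝ) + 1) := by
  have h1 : ∫ ω, X ω ^ m ∂D = ∫ t, t ^ m ∂(D.map X) :=
    (integral_map hX.aemeasurable (continuous_pow m).aestronglyMeasurable).symm
  rw [h1, map_eq_of_isUniform_Icc h, integral_Icc_eq_integral_Ioc,
    ← intervalIntegral.integral_of_le zero_le_one, integral_pow]
  simp

variable {Y : Ω → ℝ}

theorem integrable_mul_pow_of_isUniform (hX : Measurable X) (hY : Measurable Y)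
    (hXu : pdf.IsUniform X (Set.Icc 0 1) D volume)
    (hYu : pdf.IsUniform Y (Set.Icc 0 1) D volume) (hXY : IndepFun X Y D) (m : ℕ) :
    Integrable (fun ω => Y ω * X ω ^ m) D := by
  have hY1 : Integrable Y D := by simpa using integrable_pow_of_isUniform hY hYu 1
  have hind : IndepFun Y (fun ω => X ω ^ m) D :=
    hXY.symm.comp measurable_id (measurable_id.pow_const m)
  exact hind.integrable_mul hY1 (integrable_pow_of_isUniform hX hXu m)

theorem integral_mul_pow_of_isUniform (hX : Measurable X) (hY : Measurable Y)
    (hXu : pdf.IsUniform X (Set.Icc 0 1) D volume)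
    (hYu : pdf.IsUniform Y (Set.Icc 0 1) D volume) (hXY : IndepFun X Y D) (m : ℕ) :
    ∫ ω, Y ω * X ω ^ m ∂D = 1 / 2 * (1 / ((m : ℝ) + 1)) := by
  have hind : IndepFun Y (fun ω => X ω ^ m) D :=
    hXY.symm.comp measurable_id (measurable_id.pow_const m)
  have hY1 : ∫ ω, Y ω ∂D = 1 / 2 := by
    have := integral_pow_of_isUniform hY hYu 1
    norm_num at this
    rw [this, one_div]
  rw [hind.integral_fun_mul_eq_mul_integral hY.aestronglyMeasurable
    (hX.pow_const m).aestronglyMeasurable, hY1, integral_pow_of_isUniform hX hXu m]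

end Uniform

/-! ### Outcomes of the mechanism without eligible set. -/

namespace MSPM

variable {n : ℕ} {Ω : Type*} [MeasurableSpace Ω]

theorem mem_best_of_winner_eq_some {M : MSPM n Ω} {x : Ω → ℝ} {p : Fin n → Option Ω} {i : Fin n}
    (h : M.winner x p = some i) : i ∈ M.best x p := by
  unfold winner at h
  split_ifs at h with hne
  rw [← Option.some.inj h]
  exact M.tieBreak.choose_mem _ hne

theorem le_of_winner_unrestricted {ρ : TieBreakingRule n} {x : Ω → ℝ} {p : Fin n → Option Ω}
    {i j : Fin n} {ω ω' : Ω} (h : (unrestricted n Ω ρ).winner x p = some i)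
    (hi : p i = some ω) (hj : p j = some ω') : x ω' ≤ x ω := by
  have hmem := mem_best_of_winner_eq_some h
  simp only [best, Finset.mem_filter, Finset.mem_univ, true_and] at hmem
  obtain ⟨ω₁, h1, -, h2⟩ := hmem
  obtain rfl : ω₁ = ω := by simpa [h1] using hi
  exact h2 j ω' hj (Set.mem_univ _)

theorem winner_unrestricted_ne_none {ρ : TieBreakingRule n} {x : Ω → ℝ} {q : Fin n → Ω}
    (hn : 0 < n) : (unrestricted n Ω ρ).winner x (fun i => some (q i)) ≠ none := by
  have : Nonempty (Fin n) := ⟨⟨0, hn⟩⟩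
  obtain ⟨i, hi⟩ := Finite.exists_max fun i => x (q i)
  have hne : ((unrestricted n Ω ρ).best x (fun i => some (q i))).Nonempty := by
    refine ⟨i, ?_⟩
    simp only [best, Finset.mem_filter, Finset.mem_univ, true_and]
    refine ⟨q i, rfl, Set.mem_univ _, fun j ω' hj _ => ?_⟩
    rw [← Option.some.inj hj]
    exact hi j
  simp [winner, hne]

/-- If every agent makes a proposal, the principal obtains the largest proposed value. -/
theorem principalPayoff_unrestricted_eq_iSup {ρ : TieBreakingRule n} {x : Ω → ℝ} {q : Fin n → Ω}
    (hn : 0 < n) :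
    (unrestricted n Ω ρ).principalPayoff x (fun i => some (q i)) = ⨆ i, x (q i) := by
  have : Nonempty (Fin n) := ⟨⟨0, hn⟩⟩
  obtain ⟨i, hi⟩ := Option.ne_none_iff_exists'.1
    (winner_unrestricted_ne_none (ρ := ρ) (x := x) (q := q) hn)
  have hle : ∀ j, x (q j) ≤ x (q i) := fun j => le_of_winner_unrestricted hi rfl rfl
  simp only [principalPayoff, hi, Option.elim_some]
  exact le_antisymm (le_ciSup (Set.finite_range fun j => x (q j)).bddAbove i) (ciSup_le hle)

end MSPM

namespace Agents

variable {n : ℕ} {Ω : Type*} [MeasurableSpace Ω]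

instance isProbabilityMeasure_agentPrior (A : Agents n Ω) (i : Fin n) :
    IsProbabilityMeasure (A.agentPrior i) := by
  unfold agentPrior; infer_instance

instance isProbabilityMeasure_prior (A : Agents n Ω) : IsProbabilityMeasure A.prior := by
  unfold prior; infer_instance

/-! ### Existence of an `x`-best, Pareto-optimal profile. -/

section ParetoOptimal

variable (A : Agents n Ω) (x : Ω → ℝ) (i : Fin n)

/-- The `j`-th observed solution is maximal for the lexicographic order on the utilities of the
principal and of agent `i`. -/
def IsLexBest (v : Fin (A.k i) → Ω) (j : Fin (A.k i)) : Prop :=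
  ∀ j', x (v j') < x (v j) ∨ (x (v j') = x (v j) ∧ A.y i (v j') ≤ A.y i (v j))

/-- The first lexicographically best observed solution. -/
def IsFirstLexBest (v : Fin (A.k i) → Ω) (j : Fin (A.k i)) : Prop :=
  A.IsLexBest x i v j ∧ ∀ j' < j, ¬ A.IsLexBest x i v j'

theorem measurableSet_isLexBest (hx : Measurable x) (j : Fin (A.k i)) :
    MeasurableSet {v | A.IsLexBest x i v j} := by
  have hX : ∀ j, Measurable fun v : Fin (A.k i) → Ω => x (v j) :=
    fun j => hx.comp (measurable_pi_apply j)
  have hY : ∀ j, Measurable fun v : Fin (A.k i) → Ω => A.y i (v j) :=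
    fun j => (A.measurable_y i).comp (measurable_pi_apply j)
  simp only [IsLexBest, Set.ofPred_forall]
  exact MeasurableSet.iInter fun j' => (measurableSet_lt (hX j') (hX j)).union
    ((measurableSet_eq_fun (hX j') (hX j)).inter (measurableSet_le (hY j') (hY j)))

theorem measurableSet_isFirstLexBest (hx : Measurable x) (j : Fin (A.k i)) :
    MeasurableSet {v | A.IsFirstLexBest x i v j} := by
  simp only [IsFirstLexBest, Set.ofPred_and, Set.ofPred_forall]
  exact (A.measurableSet_isLexBest x i hx j).inter
    (MeasurableSet.iInter fun j' => MeasurableSet.iInter fun _ =>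
      (A.measurableSet_isLexBest x i hx j').compl)

variable {A x i}

theorem exists_isFirstLexBest (hk : 0 < A.k i) (v : Fin (A.k i) → Ω) :
    ∃ j, A.IsFirstLexBest x i v j := by
  have : Nonempty (Fin (A.k i)) := ⟨⟨0, hk⟩⟩
  have hex : ∃ j, A.IsLexBest x i v j := by
    obtain ⟨j, hj⟩ := Finite.exists_max fun j => toLex (x (v j), A.y i (v j))
    exact ⟨j, fun j' => by simpa [Prod.Lex.toLex_le_toLex] using hj j'⟩
  obtain ⟨j, hj, hmin⟩ := WellFounded.has_min (wellFounded_lt (α := Fin (A.k i)))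
    {j | A.IsLexBest x i v j} hex
  exact ⟨j, hj, fun j' hlt hj' => hmin j' hj' hlt⟩

/-- Uniqueness is what makes the strategy below measurable: a choice function among first
lexicographic maxima has no freedom. -/
theorem IsFirstLexBest.eq {v : Fin (A.k i) → Ω} {j j' : Fin (A.k i)}
    (h : A.IsFirstLexBest x i v j) (h' : A.IsFirstLexBest x i v j') : j = j' := by
  rcases lt_trichotomy j j' with hlt | heq | hlt
  · exact absurd h.1 (h'.2 j hlt)
  · exact heq
  · exact absurd h'.1 (h.2 j' hlt)

variable (A x i)

/-- The strategy that proposes the first lexicographically best observed solution. -/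
noncomputable def lexStrategy (hx : Measurable x) (hk : 0 < A.k i) : A.Strategy i where
  select v := some (exists_isFirstLexBest (x := x) hk v).choose
  measurableSet_select j := by
    -- By uniqueness, the event that `j` is selected is exactly the measurable event that `j` is the
    -- first lexicographic maximum.
    convert A.measurableSet_isFirstLexBest x i hx j using 1
    ext v
    have hspec := (exists_isFirstLexBest (x := x) hk v).choose_spec
    simp only [Set.mem_ofPred_eq, Option.some.injEq]
    exact ⟨fun h => h ▸ hspec, fun h => hspec.eq h⟩

theorem exists_isXBest_isParetoOptimal (hx : Measurable x) (hk : ∀ i, 0 < A.k i) :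
    ∃ σ : (i : Fin n) → A.Strategy i, A.IsXBest x σ ∧ A.IsParetoOptimal x σ := by
  have hspec : ∀ i v j, (A.lexStrategy x i hx (hk i)).select v = some j →
      A.IsLexBest x i v j := by
    intro i v j h
    have h1 := (exists_isFirstLexBest (x := x) (hk i) v).choose_spec.1
    rwa [Option.some.inj h] at h1
  refine ⟨fun i => A.lexStrategy x i hx (hk i), fun i v => ?_, fun i v j h => ?_⟩
  · refine ⟨_, rfl, fun j' => ?_⟩
    rcases hspec i v _ rfl j' with h | h
    exacts [h.le, h.1.le]
  · rintro ⟨j', h1, h2, h3⟩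
    rcases hspec i v j h j' with h4 | ⟨h4, h5⟩
    · exact absurd h1 h4.not_ge
    · rcases h3 with h3 | h3
      exacts [h3.ne' h4, h3.not_ge h5]

end ParetoOptimal

/-! ### Payoffs against `x`-best opponents. -/

variable {A : Agents n Ω} {x : Ω → ℝ}

theorem IsXBest.principalUtility_unrestricted {σ : (i : Fin n) → A.Strategy i}
    (hσ : A.IsXBest x σ) (hn : 0 < n) (ρ : TieBreakingRule n) :
    A.principalUtility x (MSPM.unrestricted n Ω ρ) σ = A.opt x := by
  choose j hj hmax using hσ
  refine integral_congr_ae (Filter.Eventually.of_forall fun w => ?_)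
  have hsig : (fun i => (σ i).signal (w i)) = fun i => some (w i (j i (w i))) := by
    funext i
    simp [Strategy.signal, hj]
  simp only [hsig]
  rw [MSPM.principalPayoff_unrestricted_eq_iSup hn]
  refine iSup_congr fun i => ?_
  have : Nonempty (Fin (A.k i)) := ⟨j i (w i)⟩
  exact le_antisymm (le_ciSup (Set.finite_range fun l => x (w i l)).bddAbove (j i (w i)))
    (ciSup_le (hmax i (w i)))

/-- The probability that no solution of the other agents is better than `t` for the principal. -/
theorem prior_forall_le {k : ℕ} {D : Measure Ω} (hA : A.IsSymmetric k D) (hx : Measurable x)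
    (hu : A.UniformUtilities x) (i : Fin n) {t : ℝ} (ht : t ∈ Set.Icc (0 : ℝ) 1) :
    A.prior {w | ∀ l, l ≠ i → ∀ j, x (w l j) ≤ t} = ENNReal.ofReal (t ^ (k * (n - 1))) := by
  classical
  -- The event is a product box, free in the coordinate `i`, so its measure factorizes over agents
  -- and draws.
  have hset : {w : (l : Fin n) → Fin (A.k l) → Ω | ∀ l, l ≠ i → ∀ j, x (w l j) ≤ t} =
      Set.univ.pi fun l => if l = i then Set.univ
        else Set.univ.pi fun _ => {ω | x ω ≤ t} := by
    ext w
    simp only [Set.mem_ofPred_eq, Set.mem_univ_pi]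
    refine forall_congr' fun l => ?_
    by_cases hl : l = i <;> simp [hl]
  have hl : ∀ l, A.agentPrior l (if l = i then Set.univ
      else Set.univ.pi fun _ => {ω | x ω ≤ t}) =
      if l = i then 1 else ENNReal.ofReal t ^ k := by
    intro l
    split_ifs with h
    · exact measure_univ
    · rw [agentPrior, Measure.pi_pi]
      simp [measure_le_of_isUniform hx (hu l _).1 ht, hA.1 l]
  rw [hset, prior, Measure.pi_pi, Finset.prod_congr rfl fun l _ => hl l, Finset.prod_ite]
  simp only [Finset.prod_const, one_pow, one_mul]
  rw [Finset.filter_ne', Finset.card_erase_of_mem (Finset.mem_univ i), Finset.card_univ,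
    Fintype.card_fin, ← pow_mul, ENNReal.ofReal_pow ht.1]

theorem agentPayoff_nonneg {M : MSPM n Ω} {i : Fin n} {p : Fin n → Option Ω} {yi : Ω → ℝ}
    (h : ∀ ω, p i = some ω → 0 ≤ yi ω) : 0 ≤ M.agentPayoff x i yi p := by
  unfold MSPM.agentPayoff
  split_ifs
  · cases hp : p i with
    | none => simp
    | some ω => simpa using h ω hp
  · exact le_rfl

theorem interimUtility_nonneg {M : MSPM n Ω} {i : Fin n} {s : Option Ω}
    {σ : (l : Fin n) → A.Strategy l} (h : ∀ ω, s = some ω → 0 ≤ A.y i ω) :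
    0 ≤ A.interimUtility x M i s σ :=
  integral_nonneg fun w => agentPayoff_nonneg fun ω hω => h ω (by simpa using hω)

theorem interimUtility_none (M : MSPM n Ω) (i : Fin n) (σ : (l : Fin n) → A.Strategy l) :
    A.interimUtility x M i none σ = 0 := by
  simp [interimUtility, MSPM.agentPayoff]

/-- Against agents who propose their best solutions for the principal, a proposal is accepted with
probability at most `x ω ^ (k * (n - 1))`. -/
theorem IsXBest.interimUtility_some_le {k : ℕ} {D : Measure Ω} (hA : A.IsSymmetric k D)
    (hx : Measurable x) (hu : A.UniformUtilities x) {σ : (l : Fin n) → A.Strategy l}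
    (hσ : A.IsXBest x σ) (ρ : TieBreakingRule n) (i : Fin n) {ω : Ω}
    (hxω : x ω ∈ Set.Icc (0 : ℝ) 1) (hyω : 0 ≤ A.y i ω) :
    A.interimUtility x (MSPM.unrestricted n Ω ρ) i (some ω) σ ≤
      A.y i ω * x ω ^ (k * (n - 1)) := by
  set S : Set ((l : Fin n) → Fin (A.k l) → Ω) :=
    {w | ∀ l, l ≠ i → ∀ j, x (w l j) ≤ x ω} with hS
  have hSm : MeasurableSet S := by
    simp only [hS, Set.ofPred_forall]
    exact MeasurableSet.iInter fun l => MeasurableSet.iInter fun _ => MeasurableSet.iInter fun j =>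
      measurableSet_le
        (hx.comp ((measurable_pi_apply j).comp (measurable_pi_apply l))) measurable_const
  have hint : ∫ w, S.indicator (fun _ => A.y i ω) w ∂A.prior =
      A.y i ω * x ω ^ (k * (n - 1)) := by
    rw [integral_indicator_const _ hSm, measureReal_def, prior_forall_le hA hx hu i hxω,
      ENNReal.toReal_ofReal (pow_nonneg hxω.1 _), smul_eq_mul, mul_comm]
  rw [← hint]
  -- Only the upper bound has to be integrable; the payoff itself just has to be nonnegative.
  refine integral_mono_of_nonneg (Filter.Eventually.of_forall fun w => ?_)
    ((integrable_const _).indicator hSm) (Filter.Eventually.of_forall fun w => ?_)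
  · refine agentPayoff_nonneg fun ω' hω' => ?_
    obtain rfl : ω = ω' := by simpa using hω'
    exact hyω
  · by_cases hw : (MSPM.unrestricted n Ω ρ).winner x
        (Function.update (fun l => (σ l).signal (w l)) i (some ω)) = some i
    -- `S` is defined by `≤`, so it also contains the ties, whichever way `ρ` breaks them.
    · have hwS : w ∈ S := by
        intro l hl j
        obtain ⟨j₀, hj₀, hmax⟩ := hσ l (w l)
        refine (hmax j).trans (MSPM.le_of_winner_unrestricted (j := l) hw (by simp) ?_)
        simp [hl, Strategy.signal, hj₀]
      simp [MSPM.agentPayoff, hw, hwS]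
    · simp only [MSPM.agentPayoff, if_neg hw]
      exact Set.indicator_nonneg (fun _ _ => hyω) w

theorem ae_agentPrior {i : Fin n} {p : Ω → Prop} (h : ∀ j, ∀ᵐ ω ∂A.D i j, p ω) :
    ∀ᵐ v ∂A.agentPrior i, ∀ j, p (v j) :=
  ae_all_iff.2 fun j => (measurePreserving_eval (A.D i) j).quasiMeasurePreserving.ae (h j)

theorem UniformUtilities.ae_mem_Icc (hu : A.UniformUtilities x) (hx : Measurable x) (i : Fin n) :
    ∀ᵐ v ∂A.agentPrior i, ∀ j, x (v j) ∈ Set.Icc (0 : ℝ) 1 ∧ A.y i (v j) ∈ Set.Icc (0 : ℝ) 1 :=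
  ae_agentPrior fun j => (ae_mem_Icc_of_isUniform hx (hu i j).1).and
    (ae_mem_Icc_of_isUniform (A.measurable_y i) (hu i j).2)

theorem Strategy.exists_of_signal_eq_some {i : Fin n} {τ : A.Strategy i} {v : Fin (A.k i) → Ω}
    {ω : Ω} (h : τ.signal v = some ω) : ∃ j, ω = v j := by
  obtain ⟨j, -, hj⟩ := Option.map_eq_some_iff.1 h
  exact ⟨j, hj.symm⟩

theorem UniformUtilities.interimUtility_nonneg_ae (hu : A.UniformUtilities x) (hx : Measurable x)
    (M : MSPM n Ω) (i : Fin n) (τ : A.Strategy i) (σ : (l : Fin n) → A.Strategy l) :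
    ∀ᵐ v ∂A.agentPrior i, 0 ≤ A.interimUtility x M i (τ.signal v) σ := by
  filter_upwards [hu.ae_mem_Icc hx i] with v hv
  refine interimUtility_nonneg fun ω hω => ?_
  obtain ⟨j, rfl⟩ := Strategy.exists_of_signal_eq_some hω
  exact (hv j).2.1

/-- Against agents who propose their best solutions for the principal, no strategy yields more than
the sum over the own solutions of the expected utilities from proposing them. -/
theorem IsXBest.expectedUtility_le {k : ℕ} {D : Measure Ω} (hA : A.IsSymmetric k D)
    (hx : Measurable x) (hi : A.IndependentUtility x) (hu : A.UniformUtilities x)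
    {σ : (l : Fin n) → A.Strategy l} (hσ : A.IsXBest x σ) (ρ : TieBreakingRule n) (i : Fin n)
    (τ : A.Strategy i) :
    A.expectedUtility x (MSPM.unrestricted n Ω ρ) i τ σ ≤
      k * (1 / 2 * (1 / (((k * (n - 1) : ℕ) : ℝ) + 1))) := by
  set m := k * (n - 1)
  have hy := A.measurable_y i
  have hmp : ∀ j, MeasurePreserving (Function.eval j) (A.agentPrior i) (A.D i j) :=
    fun j => measurePreserving_eval (A.D i) j
  have hI : ∀ j, Integrable (fun ω => A.y i ω * x ω ^ m) (A.D i j) := fun j =>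
    integrable_mul_pow_of_isUniform hx hy (hu i j).1 (hu i j).2 (hi i j) m
  have hI' : ∀ j, Integrable (fun v : Fin (A.k i) → Ω => A.y i (v j) * x (v j) ^ m)
      (A.agentPrior i) := fun j => (hmp j).integrable_comp_of_integrable (hI j)
  have hval : ∀ j, ∫ v, A.y i (v j) * x (v j) ^ m ∂A.agentPrior i =
      1 / 2 * (1 / ((m : ℝ) + 1)) := by
    intro j
    rw [← integral_mul_pow_of_isUniform hx hy (hu i j).1 (hu i j).2 (hi i j) m,
      ← (hmp j).map_eq, integral_map (hmp j).aemeasurable]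
    · exact (hy.mul (hx.pow_const m)).aestronglyMeasurable
  have hsum : ∫ v, ∑ j, A.y i (v j) * x (v j) ^ m ∂A.agentPrior i =
      k * (1 / 2 * (1 / ((m : ℝ) + 1))) := by
    rw [integral_finsetSum _ fun j _ => hI' j, Finset.sum_congr rfl fun j _ => hval j]
    simp [hA.1 i]
  rw [← hsum]
  refine integral_mono_of_nonneg (hu.interimUtility_nonneg_ae hx _ i τ σ)
    (integrable_finsetSum _ fun j _ => hI' j) ?_
  filter_upwards [hu.ae_mem_Icc hx i] with v hv
  have hnn : ∀ j, 0 ≤ A.y i (v j) * x (v j) ^ m :=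
    fun j => mul_nonneg (hv j).2.1 (pow_nonneg (hv j).1.1 m)
  cases hs : τ.signal v with
  | none =>
    rw [interimUtility_none]
    exact Finset.sum_nonneg fun j _ => hnn j
  | some ω =>
    obtain ⟨j, rfl⟩ := Strategy.exists_of_signal_eq_some hs
    -- Whichever index `j` the strategy picks, its term is one of the nonnegative summands.
    exact (hσ.interimUtility_some_le hA hx hu ρ i (hv j).1 (hv j).2.1).trans
      (Finset.single_le_sum (f := fun j => A.y i (v j) * x (v j) ^ m)
        (fun j _ => hnn j) (Finset.mem_univ j))

/-! ### The numerical bound, the equilibrium and the limit. -/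

theorem mul_half_mul_inv_le_one_sub_exp {n : ℕ} (hn : 2 ≤ n) (k : ℕ) :
    k * (1 / 2 * (1 / (((k * (n - 1) : ℕ) : ℝ) + 1))) ≤
      1 - Real.exp (-((n : ℝ) ^ 2 / (2 * ((n : ℝ) - 1) ^ 2))) := by
  obtain ⟨r, rfl⟩ : ∃ r, n = r + 1 := ⟨n - 1, by omega⟩
  have hr : (1 : ℝ) ≤ r := by exact_mod_cast (by omega : 1 ≤ r)
  have hk : (0 : ℝ) ≤ k := k.cast_nonneg
  simp only [Nat.add_sub_cancel]
  push_cast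
  rw [add_sub_cancel_right]
  set s := (r : ℝ)
  have hs : (0 : ℝ) < s := by linarith
  -- The bound is made uniform in `k`, with `s = n - 1`.
  have h1 : (k : ℝ) * (1 / 2 * (1 / (k * s + 1))) ≤ 1 / (2 * s) := by
    rw [← mul_div_mul_comm, mul_one, ← mul_div_assoc, div_le_div_iff₀ (by positivity) (by positivity)]
    nlinarith
  set a : ℝ := (s + 1) ^ 2 / (2 * s ^ 2) with ha
  have ha0 : 0 < 1 + a := by positivity
  -- This is `1 + a ≤ exp a`, inverted.
  have h2 : Real.exp (-a) ≤ 1 / (1 + a) := by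
    rw [Real.exp_neg, ← one_div]
    exact one_div_le_one_div_of_le ha0 (by linarith [Real.add_one_le_exp a])
  have h3 : 1 / (1 + a) = 2 * s ^ 2 / (2 * s ^ 2 + (s + 1) ^ 2) := by
    rw [ha]; field_simp
  -- After clearing denominators this reads `1 ≤ 2 * s ^ 3 + s ^ 2`, which holds since `s ≥ 1`.
  have h4 : 1 / (2 * s) + 2 * s ^ 2 / (2 * s ^ 2 + (s + 1) ^ 2) ≤ 1 := by
    rw [div_add_div _ _ (by positivity) (by positivity), div_le_one (by positivity)]
    nlinarith [pow_le_pow_left₀ zero_le_one hr 3, sq_nonneg s]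
  linarith

theorem IsXBest.isApproxBNE {k : ℕ} {D : Measure Ω} (hn : 2 ≤ n) (hA : A.IsSymmetric k D)
    (hx : Measurable x) (hi : A.IndependentUtility x) (hu : A.UniformUtilities x)
    {σ : (l : Fin n) → A.Strategy l} (hσ : A.IsXBest x σ) (ρ : TieBreakingRule n) :
    A.IsApproxBNE x (MSPM.unrestricted n Ω ρ)
      (1 - Real.exp (-((n : ℝ) ^ 2 / (2 * ((n : ℝ) - 1) ^ 2)))) σ := by
  intro i τ
  have h1 := hσ.expectedUtility_le hA hx hi hu ρ i τ
  have h2 := mul_half_mul_inv_le_one_sub_exp hn k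
  have h3 : 0 ≤ A.expectedUtility x (MSPM.unrestricted n Ω ρ) i (σ i) σ :=
    integral_nonneg_of_ae (hu.interimUtility_nonneg_ae hx _ i (σ i) σ)
  linarith

end Agents

theorem tendsto_one_sub_exp_neg_sq_div :
    Filter.Tendsto (fun m : ℕ => 1 - Real.exp (-((m : ℝ) ^ 2 / (2 * ((m : ℝ) - 1) ^ 2))))
      Filter.atTop (nhds (1 - 1 / Real.sqrt (Real.exp 1))) := by
  -- The `1 - 0` matches the limit of `1 - m⁻¹`, obtained by cancelling `m ^ 2` in the exponent.
  have hlim : 1 / Real.sqrt (Real.exp 1) = Real.exp (-(1 / (2 * (1 - 0) ^ 2))) := by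
    rw [Real.sqrt_eq_rpow, ← Real.exp_mul, one_div, ← Real.exp_neg]
    norm_num
  rw [hlim]
  have h0 : Filter.Tendsto (fun m : ℕ => ((m : ℝ))⁻¹) Filter.atTop (nhds 0) :=
    tendsto_inv_atTop_nhds_zero_nat
  have h1 : Filter.Tendsto (fun m : ℕ => 1 - Real.exp (-(1 / (2 * (1 - ((m : ℝ))⁻¹) ^ 2))))
      Filter.atTop (nhds (1 - Real.exp (-(1 / (2 * (1 - 0) ^ 2))))) := by
    refine tendsto_const_nhds.sub ((Real.continuous_exp.tendsto _).comp (Filter.Tendsto.neg ?_))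
    exact tendsto_const_nhds.div (((tendsto_const_nhds.sub h0).pow 2).const_mul 2) (by norm_num)
  refine h1.congr' ?_
  filter_upwards [Filter.eventually_gt_atTop 0] with m hm
  have hm' : (m : ℝ) ≠ 0 := by exact_mod_cast hm.ne'
  have h2 : (m : ℝ) - 1 = m * (1 - (m : ℝ)⁻¹) := by field_simp
  rw [h2, mul_pow, mul_left_comm, ← mul_one ((m : ℝ) ^ 2), mul_assoc, one_mul,
    mul_div_mul_left _ _ (pow_ne_zero 2 hm')]

end Delegation

theorem mainTheorem2 (n : ℕ) (hn : 2 ≤ n) {Ω : Type*} [MeasurableSpace Ω]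
    (x : Ω → ℝ) (hx : Measurable x) (ρ : Delegation.TieBreakingRule n) :
    (∀ (A : Delegation.Agents n Ω) (k : ℕ) (D : Measure Ω), 2 ≤ k → A.IsSymmetric k D →
      A.IndependentUtility x → A.UniformUtilities x →
      (∃ σ : (i : Fin n) → A.Strategy i, A.IsXBest x σ ∧ A.IsParetoOptimal x σ) ∧
      ∀ σ : (i : Fin n) → A.Strategy i, A.IsXBest x σ →
        A.IsApproxBNE x (Delegation.MSPM.unrestricted n Ω ρ)
          (1 - Real.exp (-((n : ℝ) ^ 2 / (2 * ((n : ℝ) - 1) ^ 2)))) σ ∧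
        A.principalUtility x (Delegation.MSPM.unrestricted n Ω ρ) σ = A.opt x) ∧
    Filter.Tendsto (fun m : ℕ => 1 - Real.exp (-((m : ℝ) ^ 2 / (2 * ((m : ℝ) - 1) ^ 2))))
      Filter.atTop (nhds (1 - 1 / Real.sqrt (Real.exp 1))) := by
  refine ⟨fun A k D hk hA hi hu => ⟨?_, fun σ hσ => ⟨?_, ?_⟩⟩,
    Delegation.tendsto_one_sub_exp_neg_sq_div⟩
  · exact A.exists_isXBest_isParetoOptimal x hx fun i => by rw [hA.1 i]; omega
  · exact hσ.isApproxBNE hn hA hx hi hu ρ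
  · exact hσ.principalUtility_unrestricted (by omega) ρ
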